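/- **Loss of mass and extinction time.** Let $u_0\in L^1(\mathbb R)$ be nonnegative and compactly supported, and let $u$ be the solution of the Cauchy problem on $\mathbb R$ for the total variation flow $\partial_t u=\partial_x\!\left(\frac{Du}{|Du|}\right)$ with $u(0)=u_0$, that is: $u\in C([0,\infty);L^1(\mathbb R))$, $u(0)=u_0$, and for every $\tau>0$ the function $u(\tau+\cdot)$ is a strong solution. Here $w$ is a strong solution if $w\in L^\infty([0,\infty);BV(\mathbb R))\cap W^{1,2}_{\rm loc}([0,\infty);L^2(\mathbb R))$ and there is a measurable $z:(0,\infty)\times\mathbb R\to[-1,1]$ such that $\partial_t w=\partial_x z$ on $(0,\infty)\times\mathbb R$ (so that $z(t,\cdot)$ is locally absolutely continuous for a.e. $t$) and $\int_{\mathbb R} z(t,x)\,Dw(t,dx)=|Dw(t)|(\mathbb R)$ for a.e. $t>0$. ($BV(\mathbb R)$ is the set of locally integrable functions whose distributional derivative is a finite signed measure, and the $L^\infty([0,\infty);BV(\mathbb R))$ condition means that the total variation $|Dw(t)|(\mathbb R)$ is essentially bounded in $t$.) Set $T=\frac12\int_{\mathbb R}u_0(x)\,dx$. Then $$\int_{\mathbb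 R}u(t,x)\,dx=\int_{\mathbb R}u_0(x)\,dx-2t=2(T-t)\qquad\text{for all }0\le t\le T,$$ and $T$ is exactly the extinction time of $u$: $u(t)=0$ a.e. on $\mathbb R$ for all $t\ge T$, and $T$ is the smallest nonnegative time with this property. -/

import Mathlib

open MeasureTheory Set Filter
open scoped Topology ContDiff

namespace TVFlow

/-- `f` is locally integrable on `ℝ` and its distributional derivative is the (finite) signed
measure `μ`, i.e. `f` is a function of bounded variation with `Df = μ` and total variation
`|Df|(ℝ) = μ.variation univ`. -/
def HasMeasureDeriv (f : ℝ → ℝ) (μ : SignedMeasure ℝ) : Prop :=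
  LocallyIntegrable f ∧
    ∀ φ : ℝ → ℝ, ContDiff ℝ ∞ φ → HasCompactSupport φ →
      ∫ x, f x * deriv φ x = -∫ᵛ x, φ x ∂•μ

/-- `u` belongs to `W^{1,2}_loc([0,∞); L²(ℝ))` with time derivative `∂ₜu = v`: both are jointly
measurable and square integrable on `(0,T) × ℝ` for every `T`, and `u` is the continuous
representative, `u(t) = u(s) + ∫ₛᵗ v(r) dr` in `L²(ℝ)` for all `0 ≤ s ≤ t`. -/
structure HasTimeDerivL2 (u v : ℝ → ℝ → ℝ) : Prop where
  memLp : ∀ T > 0, MemLp (Function.uncurry u) 2 ((volume.restrict (Ioo 0 T)).prod volume)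
  memLp_deriv : ∀ T > 0, MemLp (Function.uncurry v) 2 ((volume.restrict (Ioo 0 T)).prod volume)
  integral_eq : ∀ s t : ℝ, 0 ≤ s → s ≤ t → ∀ᵐ x, u t x - u s x = ∫ r in s..t, v r x

/-- Strong solutions of the total variation flow `∂ₜu = ∂ₓ(Du/|Du|)` on `(0,∞) × ℝ`:
`u ∈ L^∞([0,∞); BV(ℝ)) ∩ W^{1,2}_loc([0,∞); L²(ℝ))` and there is a field `z` with `|z| ≤ 1`,
`∂ₜu = ∂ₓz` and `∫ z dDu = |Du|(ℝ)` for almost every time. For almost every `t` the function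
`z(t,·)` is (locally absolutely) continuous, being the primitive of `∂ₜu(t,·)`. -/
structure IsStrongSolution (u : ℝ → ℝ → ℝ) : Prop where
  bounded_variation : ∃ C : ℝ, ∀ᵐ t ∂(volume.restrict (Ioi (0 : ℝ))),
    ∃ μ : SignedMeasure ℝ, HasMeasureDeriv (u t) μ ∧ μ.variation univ ≤ ENNReal.ofReal C
  exists_field : ∃ v z : ℝ → ℝ → ℝ,
    HasTimeDerivL2 u v ∧
    AEStronglyMeasurable (Function.uncurry z) ((volume.restrict (Ioi (0 : ℝ))).prod volume) ∧
    ∀ᵐ t ∂(volume.restrict (Ioi (0 : ℝ))),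
      (∀ x, |z t x| ≤ 1) ∧
      (∀ x y, z t y - z t x = ∫ r in x..y, v t r) ∧
      ∃ μ : SignedMeasure ℝ, HasMeasureDeriv (u t) μ ∧
        ∫ᵛ x, z t x ∂•μ = μ.variation.real univ

/-- Solutions `u(t,x)`, `t ≥ 0`, of the Cauchy problem on `ℝ` for the total variation flow with
datum `u₀ ∈ L¹(ℝ)`: `u ∈ C([0,∞); L¹(ℝ))`, `u(0) = u₀`, and `u` is a strong solution on `[τ,∞)`
for every `τ > 0`. -/
structure IsCauchySolution (u₀ : ℝ → ℝ) (u : ℝ → ℝ → ℝ) : Prop where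
  integrable : ∀ t, 0 ≤ t → Integrable (u t)
  continuous : ∀ t, 0 ≤ t → Tendsto (fun s => ∫ x, |u s x - u t x|) (𝓝[Ici 0] t) (𝓝 0)
  initial : u 0 =ᵐ[volume] u₀
  strong : ∀ τ, 0 < τ → IsStrongSolution fun t => u (τ + t)

/-- `T` is the extinction time of `u`: the first time from which on `u` vanishes. -/
def IsExtinctionTime (u : ℝ → ℝ → ℝ) (T : ℝ) : Prop :=
  IsLeast {s : ℝ | 0 ≤ s ∧ ∀ t, s ≤ t → u t =ᵐ[volume] 0} T

end TVFlow

/-!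
Write `v = ∂ₜu`, so that at almost every time `z' = v`, `|z| ≤ 1` and `∫ z dDu = |Du|(ℝ)`. The last
identity forces `z = 1` where `Du` is positive and `z = -1` where it is negative. It is used only in
the following form, recorded in `Calibrates`: wherever a mollification of `u(t)` increases
(decreases), the field equals `1` (`-1`) at a point within the mollification radius. This follows
because the derivative of `φ * u` is `φ * Du` (`deriv_mollify`), and it replaces fine properties of
functions of bounded variation.

*Maximum principle.* For smooth nondecreasing `G` vanishing below a positive level, integration by
parts of `∫ G(φ * u) z'` and the sign of `z` give `∫ G(u) v ≤ 0` on the line and on every half-line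
(`Calibrates.setIntegral_comp_mul_nonpos`). With `H' = G`, the chain rule in time shows that
`∫ H(u(t))` is nonincreasing there (`HasTimeDerivL2.integral_levelExcess_le`). As `H` is Lipschitz,
`L¹`-continuity at `t = 0` carries the comparison down to the initial datum. Applied to `u` and `-u`,
this shows that `u` stays nonnegative and supported in an interval `[A, B]` containing the support
of the datum (`IsCalibratedFlow.ae_nonpos`, `IsCalibratedFlow.ae_eq_zero`).

*Flux.* Where `u ≥ 0` vanishes it is minimal in time, so `v = 0` there
(`HasTimeDerivL2.ae_deriv_eq_zero`). If `u(t)` is not zero, let `a` be the leftmost point with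
`z = 1`. Mass of `u(t)` to the left of `a` would produce a further such point, so `u(t) = 0` and
`v = 0` on `(-∞, a)` and `z` is constant there. Hence `z(A) = 1`, and by reflection `z(B) = -1`
(`Calibrates.sub_eq_neg_two`).

*Mass.* The mass changes at the rate `z(B) - z(A)`, which is `-2` as long as `u` is not zero and `0`
otherwise. Since the mass is nonincreasing, it equals `max (∫ u₀ - 2t) 0`
(`IsCalibratedFlow.mass_eq_max`), which gives the formula for the mass and the extinction time.
-/

namespace TVFlow

open ContinuousLinearMap (lsmul)

/-! ### Mollification -/

/-- The mollification `φ * f` of `f` by the normalised bump function `φ`. -/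
noncomputable def mollify (φ : ContDiffBump (0 : ℝ)) (f : ℝ → ℝ) (x : ℝ) : ℝ :=
  ∫ y, φ.normed volume (x - y) * f y

lemma mollify_eq_convolution (φ : ContDiffBump (0 : ℝ)) (f : ℝ → ℝ) :
    mollify φ f = convolution (φ.normed volume) f (lsmul ℝ ℝ) volume := by
  ext x
  rw [convolution_eq_swap]
  rfl

lemma mollify_neg (φ : ContDiffBump (0 : ℝ)) (f : ℝ → ℝ) (x : ℝ) :
    mollify φ (fun y => -f y) x = -mollify φ f x := by
  simp [mollify, integral_neg]

lemma mollify_comp_neg (φ : ContDiffBump (0 : ℝ)) (f : ℝ → ℝ) (x : ℝ) :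
    mollify φ (fun y => f (-y)) x = mollify φ f (-x) := by
  unfold mollify
  rw [← integral_neg_eq_self (fun y => φ.normed volume (x - y) * f (-y))]
  congr 1
  ext y
  rw [← φ.normed_neg]
  simp only [neg_neg]
  congr 2
  ring

lemma contDiff_mollify (φ : ContDiffBump (0 : ℝ)) {f : ℝ → ℝ} (hf : LocallyIntegrable f) :
    ContDiff ℝ 1 (mollify φ f) := by
  rw [mollify_eq_convolution]
  exact φ.hasCompactSupport_normed.contDiff_convolution_left _ (φ.contDiff_normed (n := 1)) hf

/-- The derivative of `φ * f` is `φ * Df`. -/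
lemma deriv_mollify (φ : ContDiffBump (0 : ℝ)) {f : ℝ → ℝ} {μ : SignedMeasure ℝ}
    (h : HasMeasureDeriv f μ) (x : ℝ) :
    deriv (mollify φ f) x = ∫ᵛ y, φ.normed volume (x - y) ∂•μ := by
  have h1 : HasDerivAt (mollify φ f)
      (convolution (deriv (φ.normed volume)) f (lsmul ℝ ℝ) volume x) x := by
    rw [mollify_eq_convolution]
    exact φ.hasCompactSupport_normed.hasDerivAt_convolution_left _ (φ.contDiff_normed) h.1 x
  have hcs : HasCompactSupport fun y => φ.normed volume (x - y) :=
    φ.hasCompactSupport_normed.comp_homeomorph (Homeomorph.subLeft x)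
  have hsm : ContDiff ℝ ∞ fun y => φ.normed volume (x - y) :=
    φ.contDiff_normed.comp (contDiff_const.sub contDiff_id)
  have h2 := h.2 _ hsm hcs
  rw [h1.deriv, convolution_eq_swap, ← neg_eq_iff_eq_neg.mpr h2, ← integral_neg]
  congr 1
  ext y
  have : deriv (fun y => φ.normed volume (x - y)) y = -deriv (φ.normed volume) (x - y) :=
    deriv_comp_const_sub _ _ _
  rw [this]
  simp [mul_comm]

/-! ### Calibrated slices -/

/-- Integration against a signed measure through its Jordan decomposition. -/
lemma integral_signedMeasure_eq_sub (μ : SignedMeasure ℝ) {g : ℝ → ℝ} (hg : Continuous g) {C : ℝ}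
    (hC : ∀ x, |g x| ≤ C) :
    ∫ᵛ x, g x ∂•μ = ∫ x, g x ∂μ.toJordanDecomposition.posPart
      - ∫ x, g x ∂μ.toJordanDecomposition.negPart := by
  conv_lhs => rw [← SignedMeasure.toSignedMeasure_toJordanDecomposition μ]
  rw [JordanDecomposition.toSignedMeasure]
  have key : ∀ ν : Measure ℝ, [IsFiniteMeasure ν] → ν.toSignedMeasure.Integrable g := by
    intro ν _
    rw [VectorMeasure.Integrable, Measure.variation_toSignedMeasure]
    exact Integrable.of_bound hg.aestronglyMeasurable C (Eventually.of_forall hC)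
  have hflip : lsmul ℝ ℝ = (lsmul ℝ ℝ : ℝ →L[ℝ] ℝ →L[ℝ] ℝ).flip := by
    ext; simp
  rw [VectorMeasure.integral_sub_vectorMeasure (key _) (key _), hflip,
    VectorMeasure.integral_toSignedMeasure, VectorMeasure.integral_toSignedMeasure]

/-- A field `z` with `|z| ≤ 1` and `∫ z dμ = |μ|(ℝ)` is `1` where `μ` is positive and `-1` where
`μ` is negative. -/
lemma ae_eq_one_of_integral_eq_variation {μ : SignedMeasure ℝ} {z : ℝ → ℝ} (hz : Continuous z)
    (hz1 : ∀ x, |z x| ≤ 1) (h : ∫ᵛ x, z x ∂•μ = μ.variation.real univ) :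
    (∀ᵐ x ∂μ.toJordanDecomposition.posPart, z x = 1) ∧
      ∀ᵐ x ∂μ.toJordanDecomposition.negPart, z x = -1 := by
  rw [integral_signedMeasure_eq_sub μ hz hz1, ← SignedMeasure.totalVariation_eq_variation,
    SignedMeasure.totalVariation, measureReal_add_apply] at h
  set p := μ.toJordanDecomposition.posPart
  set q := μ.toJordanDecomposition.negPart
  have hi : ∀ ν : Measure ℝ, [IsFiniteMeasure ν] → Integrable z ν := fun ν _ =>
    Integrable.of_bound hz.aestronglyMeasurable 1 (Eventually.of_forall hz1)
  have e1 : ∫ x, (1 - z x) ∂p = p.real univ - ∫ x, z x ∂p := by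
    rw [integral_sub (integrable_const _) (hi p)]; simp
  have e2 : ∫ x, (1 + z x) ∂q = q.real univ + ∫ x, z x ∂q := by
    rw [integral_add (integrable_const _) (hi q)]; simp
  have n1 : ∀ x, 0 ≤ 1 - z x := fun x => by have := abs_le.mp (hz1 x); linarith
  have n2 : ∀ x, 0 ≤ 1 + z x := fun x => by have := abs_le.mp (hz1 x); linarith
  have p1 : 0 ≤ ∫ x, (1 - z x) ∂p := integral_nonneg n1
  have p2 : 0 ≤ ∫ x, (1 + z x) ∂q := integral_nonneg n2
  have z1 : ∫ x, (1 - z x) ∂p = 0 := by linarith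
  have z2 : ∫ x, (1 + z x) ∂q = 0 := by linarith
  rw [integral_eq_zero_iff_of_nonneg n1 ((integrable_const _).sub (hi p))] at z1
  rw [integral_eq_zero_iff_of_nonneg n2 ((integrable_const _).add (hi q))] at z2
  constructor
  · filter_upwards [z1] with x hx
    simp only [Pi.zero_apply] at hx; linarith
  · filter_upwards [z2] with x hx
    simp only [Pi.zero_apply] at hx; linarith

/-- One time slice of the flow: `f` is the solution, `v = z'` its speed, and `z` the field. The
identity `∫ z dDf = |Df|(ℝ)` is recorded only through its effect on mollifications of `f`: where
`φ * f` increases (decreases), the field takes the value `1` (`-1`) within the radius of `φ`. -/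
structure Calibrates (f v z : ℝ → ℝ) : Prop where
  memLp : MemLp v 2
  abs_field_le : ∀ x, |z x| ≤ 1
  sub_eq : ∀ x y, z y - z x = ∫ r in x..y, v r
  pos : ∀ (φ : ContDiffBump (0 : ℝ)) (x : ℝ), 0 < deriv (mollify φ f) x →
    ∃ y, |y - x| < φ.rOut ∧ z y = 1
  neg : ∀ (φ : ContDiffBump (0 : ℝ)) (x : ℝ), deriv (mollify φ f) x < 0 →
    ∃ y, |y - x| < φ.rOut ∧ z y = -1

lemma intervalIntegrable_of_memLp_two {v : ℝ → ℝ} (hv : MemLp v 2) (a b : ℝ) :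
    IntervalIntegrable v volume a b :=
  ((hv.locallyIntegrable (by norm_num)).integrableOn_isCompact isCompact_uIcc).intervalIntegrable

lemma continuous_of_sub_eq {v z : ℝ → ℝ} (hv : MemLp v 2)
    (h : ∀ x y, z y - z x = ∫ r in x..y, v r) : Continuous z := by
  have : z = fun y => z 0 + ∫ r in (0 : ℝ)..y, v r := by
    ext y; linarith [h 0 y]
  rw [this]
  exact continuous_const.add
    (intervalIntegral.continuous_primitive (fun a b => intervalIntegrable_of_memLp_two hv a b) 0)

lemma Calibrates.continuous {f v z : ℝ → ℝ} (h : Calibrates f v z) : Continuous z :=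
  continuous_of_sub_eq h.memLp h.sub_eq

/-- If `φ * μ` is positive at `x`, the positive part of `μ` charges the ball of radius `φ.rOut`
around `x`. -/
lemma exists_of_integral_normed_pos (φ : ContDiffBump (0 : ℝ)) {ν : Measure ℝ} {x : ℝ}
    {P : ℝ → Prop} (h : 0 < ∫ y, φ.normed volume (x - y) ∂ν) (hP : ∀ᵐ y ∂ν, P y) :
    ∃ y, |y - x| < φ.rOut ∧ P y := by
  by_contra! hcon
  refine h.ne' (integral_eq_zero_of_ae ?_)
  filter_upwards [hP] with y hy
  have h1 : ¬ |y - x| < φ.rOut := fun hlt => hcon y hlt hy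
  by_contra h2
  have h3 : x - y ∈ Function.support (φ.normed volume) := h2
  rw [φ.support_normed_eq, Metric.mem_ball, dist_zero_right, Real.norm_eq_abs, abs_sub_comm] at h3
  exact h1 h3

lemma HasMeasureDeriv.calibrates {f v z : ℝ → ℝ} {μ : SignedMeasure ℝ} (h : HasMeasureDeriv f μ)
    (hv : MemLp v 2) (hz1 : ∀ x, |z x| ≤ 1) (hz : ∀ x y, z y - z x = ∫ r in x..y, v r)
    (hμ : ∫ᵛ x, z x ∂•μ = μ.variation.real univ) : Calibrates f v z := by
  obtain ⟨hp, hq⟩ := ae_eq_one_of_integral_eq_variation (continuous_of_sub_eq hv hz) hz1 hμ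
  have key : ∀ (φ : ContDiffBump (0 : ℝ)) (x : ℝ), deriv (mollify φ f) x =
      ∫ y, φ.normed volume (x - y) ∂μ.toJordanDecomposition.posPart
      - ∫ y, φ.normed volume (x - y) ∂μ.toJordanDecomposition.negPart := by
    intro φ x
    rw [deriv_mollify φ h]
    have hc : Continuous fun y => φ.normed volume (x - y) :=
      φ.continuous_normed.comp (continuous_const.sub continuous_id)
    obtain ⟨C, hC⟩ := (φ.hasCompactSupport_normed (μ := volume)).exists_bound_of_continuous
      φ.continuous_normed
    exact integral_signedMeasure_eq_sub μ hc (C := C) fun y => hC _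
  have hn : ∀ (φ : ContDiffBump (0 : ℝ)) (x : ℝ) (ν : Measure ℝ),
      0 ≤ ∫ y, φ.normed volume (x - y) ∂ν :=
    fun φ x ν => integral_nonneg fun y => φ.nonneg_normed _
  refine ⟨hv, hz1, hz, fun φ x hx => ?_, fun φ x hx => ?_⟩
  · rw [key] at hx
    exact exists_of_integral_normed_pos φ
      (by linarith [hn φ x μ.toJordanDecomposition.negPart]) hp
  · rw [key] at hx
    exact exists_of_integral_normed_pos φ
      (by linarith [hn φ x μ.toJordanDecomposition.posPart]) hq

lemma Calibrates.negate {f v z : ℝ → ℝ} (h : Calibrates f v z) :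
    Calibrates (fun x => -f x) (fun x => -v x) fun x => -z x := by
  have hd : ∀ (φ : ContDiffBump (0 : ℝ)) x, deriv (mollify φ fun x => -f x) x
      = -deriv (mollify φ f) x := by
    intro φ x
    rw [show mollify φ (fun x => -f x) = fun x => -mollify φ f x from funext (mollify_neg φ f)]
    exact deriv.fun_neg
  refine ⟨h.memLp.neg, fun x => by simpa using h.abs_field_le x, fun x y => ?_, fun φ x hx => ?_,
    fun φ x hx => ?_⟩
  · rw [intervalIntegral.integral_neg, ← h.sub_eq]; ring
  · obtain ⟨y, h1, h2⟩ := h.neg φ x (by rw [hd] at hx; linarith)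
    exact ⟨y, h1, by simp [h2]⟩
  · obtain ⟨y, h1, h2⟩ := h.pos φ x (by rw [hd] at hx; linarith)
    exact ⟨y, h1, by simp [h2]⟩

/-- Reflection in space. -/
lemma Calibrates.comp_neg {f v z : ℝ → ℝ} (h : Calibrates f v z) :
    Calibrates (fun x => f (-x)) (fun x => v (-x)) fun x => -z (-x) := by
  have hd : ∀ (φ : ContDiffBump (0 : ℝ)) x, deriv (mollify φ fun x => f (-x)) x
      = -deriv (mollify φ f) (-x) := by
    intro φ x
    rw [show mollify φ (fun x => f (-x)) = fun x => mollify φ f (-x) from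
      funext (mollify_comp_neg φ f)]
    exact deriv_comp_neg _ _
  refine ⟨h.memLp.comp_measurePreserving (Measure.measurePreserving_neg volume),
    fun x => by simpa using h.abs_field_le (-x), fun x y => ?_, fun φ x hx => ?_, fun φ x hx => ?_⟩
  · rw [intervalIntegral.integral_comp_neg, ← h.sub_eq]; ring
  · obtain ⟨y, h1, h2⟩ := h.neg φ (-x) (by rw [hd] at hx; linarith)
    exact ⟨-y, by rw [← abs_neg]; convert h1 using 2; ring, by simp [h2]⟩
  · obtain ⟨y, h1, h2⟩ := h.pos φ (-x) (by rw [hd] at hx; linarith)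
    exact ⟨-y, by rw [← abs_neg]; convert h1 using 2; ring, by simp [h2]⟩

/-! ### The level set inequality -/

/-- A primitive of an interval integrable function is absolutely continuous. -/
lemma absolutelyContinuousOnInterval_of_sub_eq {v z : ℝ → ℝ} {a b : ℝ}
    (hv : IntervalIntegrable v volume a b) (h : ∀ y, z y - z a = ∫ r in a..y, v r) :
    AbsolutelyContinuousOnInterval z a b := by
  have h1 := hv.absolutelyContinuousOnInterval_intervalIntegral (c := a) left_mem_uIcc
  have h2 : AbsolutelyContinuousOnInterval (fun _ : ℝ => z a) a b :=
    (LipschitzWith.const (z a)).lipschitzOnWith.absolutelyContinuousOnInterval (K := 0)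
  have : z = fun y => z a + ∫ r in a..y, v r := by
    ext y; linarith [h y]
  rw [this]
  simpa using h2.fun_add h1

lemma Calibrates.ae_hasDerivAt {f v z : ℝ → ℝ} (h : Calibrates f v z) :
    ∀ᵐ x, HasDerivAt z (v x) x := by
  filter_upwards [LocallyIntegrable.ae_hasDerivAt_integral
    (h.memLp.locallyIntegrable (by norm_num))] with x hx
  have : z = fun y => z 0 + ∫ r in (0 : ℝ)..y, v r := by
    ext y; linarith [h.sub_eq 0 y]
  rw [this]
  exact (hx 0).const_add _

lemma Calibrates.intervalIntegrable {f v z : ℝ → ℝ} (h : Calibrates f v z) (a b : ℝ) :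
    IntervalIntegrable v volume a b := intervalIntegrable_of_memLp_two h.memLp a b

/-- Integration by parts of `∫ G(φ * f) z'` leaves `-∫ z d(G(φ * f))`, in which `z` is within `η` of
the sign of the derivative. Vanishing of `G(φ * f)` at one end absorbs the boundary terms. -/
lemma Calibrates.integral_comp_mollify_mul_le {f v z : ℝ → ℝ} (h : Calibrates f v z)
    (hf : LocallyIntegrable f) {G : ℝ → ℝ} (hG : ContDiff ℝ 1 G) (hmono : Monotone G)
    (hG0 : ∀ s, 0 ≤ G s) (hG1 : ∀ s, G s ≤ 1) {a b : ℝ} (hab : a ≤ b) (φ : ContDiffBump (0 : ℝ))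
    {η : ℝ} (hη0 : 0 ≤ η) (hη1 : η ≤ 1)
    (hη : ∀ x ∈ Icc a b, ∀ y, |y - x| < φ.rOut → |z y - z x| ≤ η)
    (hend : G (mollify φ f a) = 0 ∨ G (mollify φ f b) = 0) :
    ∫ x in a..b, G (mollify φ f x) * v x ≤ η := by
  set F := mollify φ f
  have hFc : ContDiff ℝ 1 F := contDiff_mollify φ hf
  have hGF : ContDiff ℝ 1 fun x => G (F x) := hG.comp hFc
  have hac : AbsolutelyContinuousOnInterval (fun x => G (F x)) a b :=
    hGF.contDiffOn.absolutelyContinuousOnInterval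
  have hacz : AbsolutelyContinuousOnInterval z a b :=
    absolutelyContinuousOnInterval_of_sub_eq (h.intervalIntegrable a b) (h.sub_eq a)
  have hparts := hac.integral_mul_deriv_eq_deriv_mul hacz
  have hv : ∫ x in a..b, G (F x) * v x = ∫ x in a..b, G (F x) * deriv z x := by
    apply intervalIntegral.integral_congr_ae
    filter_upwards [h.ae_hasDerivAt] with x hx _
    rw [hx.deriv]
  have hD : ∀ x, deriv (fun x => G (F x)) x = deriv G (F x) * deriv F x := fun x =>
    deriv_comp x (hG.differentiable (by norm_num) _) (hFc.differentiable (by norm_num) _)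
  have hDc : Continuous (deriv fun x => G (F x)) := hGF.continuous_deriv le_rfl
  have hfund : ∫ x in a..b, deriv (fun x => G (F x)) x = G (F b) - G (F a) :=
    hac.integral_deriv_eq_sub
  have hG' : ∀ s, 0 ≤ deriv G s := fun s => hmono.deriv_nonneg
  -- the sign condition, up to the oscillation `η` of `z` on the scale of mollification
  have hsign : ∀ x ∈ Icc a b, (1 - η) * |deriv (fun x => G (F x)) x|
      ≤ deriv (fun x => G (F x)) x * z x := by
    intro x hx
    rw [hD, abs_mul, abs_of_nonneg (hG' _)]
    rcases lt_trichotomy (deriv F x) 0 with hneg | hzero | hpos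
    · obtain ⟨y, hy, hzy⟩ := h.neg φ x hneg
      have := abs_le.mp (hη x hx y hy)
      rw [abs_of_neg hneg]
      have h1 : z x ≤ -(1 - η) := by linarith
      have h2 : deriv G (F x) * deriv F x ≤ 0 := mul_nonpos_of_nonneg_of_nonpos (hG' _) hneg.le
      nlinarith
    · simp [hzero]
    · obtain ⟨y, hy, hzy⟩ := h.pos φ x hpos
      have := abs_le.mp (hη x hx y hy)
      rw [abs_of_pos hpos]
      have h1 : 1 - η ≤ z x := by linarith
      have h2 : 0 ≤ deriv G (F x) * deriv F x := mul_nonneg (hG' _) hpos.le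
      nlinarith
  have hint1 : IntervalIntegrable (fun x => (1 - η) * |deriv (fun x => G (F x)) x|) volume a b :=
    (continuous_const.mul hDc.abs).intervalIntegrable _ _
  have hint2 : IntervalIntegrable (fun x => deriv (fun x => G (F x)) x * z x) volume a b :=
    (hDc.mul h.continuous).intervalIntegrable _ _
  have hle := intervalIntegral.integral_mono_on hab hint1 hint2 hsign
  rw [intervalIntegral.integral_const_mul] at hle
  have habs : |G (F b) - G (F a)| ≤ ∫ x in a..b, |deriv (fun x => G (F x)) x| := by
    rw [← hfund]
    exact intervalIntegral.abs_integral_le_integral_abs hab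
  have hle2 : (1 - η) * |G (F b) - G (F a)| ≤ ∫ x in a..b, deriv (fun x => G (F x)) x * z x :=
    (mul_le_mul_of_nonneg_left habs (by linarith)).trans hle
  rw [hv, hparts]
  have za := abs_le.mp (h.abs_field_le a)
  have zb := abs_le.mp (h.abs_field_le b)
  rcases hend with he | he
  · rw [he, sub_zero, abs_of_nonneg (hG0 _)] at hle2
    rw [he]
    nlinarith [hG0 (F b), hG1 (F b)]
  · rw [he, zero_sub, abs_neg, abs_of_nonneg (hG0 _)] at hle2
    rw [he]
    nlinarith [hG0 (F a), hG1 (F a)]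

/-- A sequence of bump functions shrinking to the origin, with bounded ratio of outer to inner radius
so that mollifications converge almost everywhere. -/
noncomputable def shrinkingBump (n : ℕ) : ContDiffBump (0 : ℝ) where
  rIn := 1 / ((n : ℝ) + 1)
  rOut := 2 / ((n : ℝ) + 1)
  rIn_pos := by positivity
  rIn_lt_rOut := by gcongr; norm_num

lemma tendsto_rOut_shrinkingBump : Tendsto (fun n => (shrinkingBump n).rOut) atTop (𝓝 0) := by
  have := (tendsto_one_div_add_atTop_nhds_zero_nat (𝕜 := ℝ)).const_mul 2
  simpa [shrinkingBump, mul_one_div, div_eq_mul_inv] using this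

lemma ae_tendsto_mollify {f : ℝ → ℝ} (hf : LocallyIntegrable f) :
    ∀ᵐ x, Tendsto (fun n => mollify (shrinkingBump n) f x) atTop (𝓝 (f x)) := by
  simp_rw [mollify_eq_convolution]
  refine ContDiffBump.ae_convolution_tendsto_right_of_locallyIntegrable (K := 2)
    tendsto_rOut_shrinkingBump (Eventually.of_forall fun n => ?_) hf
  simp only [shrinkingBump]
  apply le_of_eq; ring

/-- Passage to the limit in the mollification. -/
lemma Calibrates.intervalIntegral_comp_mul_nonpos {f v z : ℝ → ℝ} (h : Calibrates f v z)
    (hf : LocallyIntegrable f) {G : ℝ → ℝ} (hG : ContDiff ℝ 1 G) (hmono : Monotone G)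
    (hG0 : ∀ s, 0 ≤ G s) (hG1 : ∀ s, G s ≤ 1) {l : ℝ} (hGl : ∀ s ≤ l, G s = 0) {a b c : ℝ}
    (hab : a ≤ b) (hc : c = a ∨ c = b) (hcl : f c < l)
    (hlim : Tendsto (fun n => mollify (shrinkingBump n) f c) atTop (𝓝 (f c))) :
    ∫ x in a..b, G (f x) * v x ≤ 0 := by
  have htend : Tendsto (fun n => ∫ x in a..b, G (mollify (shrinkingBump n) f x) * v x) atTop
      (𝓝 (∫ x in a..b, G (f x) * v x)) := by
    apply intervalIntegral.tendsto_integral_filter_of_dominated_convergence (fun x => |v x|)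
    · refine Eventually.of_forall fun n => ?_
      exact ((hG.continuous.comp (contDiff_mollify _ hf).continuous).aestronglyMeasurable).mul
        h.memLp.aestronglyMeasurable.restrict
    · refine Eventually.of_forall fun n => Eventually.of_forall fun x _ => ?_
      rw [Real.norm_eq_abs, abs_mul, abs_of_nonneg (hG0 _)]
      exact mul_le_of_le_one_left (abs_nonneg _) (hG1 _)
    · exact (h.intervalIntegrable a b).abs
    · filter_upwards [ae_tendsto_mollify hf] with x hx _
      exact ((hG.continuous.tendsto _).comp hx).mul_const _
  refine le_of_forall_pos_le_add fun ε hε => ?_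
  rw [zero_add]
  set η := min ε 1
  have hη : 0 < η := lt_min hε one_pos
  have huc : UniformContinuousOn z (Icc (a - 1) (b + 1)) :=
    isCompact_Icc.uniformContinuousOn_of_continuous h.continuous.continuousOn
  obtain ⟨δ, hδ, hδ'⟩ := Metric.uniformContinuousOn_iff.mp huc η hη
  have e1 : ∀ᶠ n in atTop, (shrinkingBump n).rOut < min δ 1 :=
    tendsto_rOut_shrinkingBump.eventually (gt_mem_nhds (lt_min hδ one_pos))
  have e2 : ∀ᶠ n in atTop, mollify (shrinkingBump n) f c < l := hlim.eventually (gt_mem_nhds hcl)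
  refine le_of_tendsto htend ?_
  filter_upwards [e1, e2] with n h1 h2
  refine (h.integral_comp_mollify_mul_le hf hG hmono hG0 hG1 hab _ hη.le (min_le_right _ _) ?_
    ?_).trans (min_le_left _ _)
  · intro x hx y hy
    have hy1 : |y - x| < 1 := hy.trans (h1.trans_le (min_le_right _ _))
    have hy2 : |y - x| < δ := hy.trans (h1.trans_le (min_le_left _ _))
    have := abs_lt.mp hy1
    exact (hδ' y ⟨by linarith [hx.1], by linarith [hx.2]⟩ x
      ⟨by linarith [hx.1], by linarith [hx.2]⟩ hy2).le
  · rcases hc with rfl | rfl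
    · exact Or.inl (hGl _ h2.le)
    · exact Or.inr (hGl _ h2.le)

/-- An integrable function is below any positive level at points arbitrarily far to the right, and
these points may be taken in a set of full measure. -/
lemma exists_gt_lt_of_integrable {f : ℝ → ℝ} (hf : Integrable f) {l : ℝ} (hl : 0 < l)
    {P : ℝ → Prop} (hP : ∀ᵐ x, P x) (N : ℝ) : ∃ x, N < x ∧ f x < l ∧ P x := by
  by_contra! hcon
  have h1 : volume {x | l ≤ ‖f x‖} < ⊤ := hf.measure_norm_ge_lt_top hl
  have h2 : volume (Ioi N) ≤ volume {x | l ≤ ‖f x‖} := by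
    apply measure_mono_ae
    filter_upwards [hP] with x hx hxN
    by_contra hlt
    have hlt' : ‖f x‖ < l := not_le.mp hlt
    exact hcon x hxN ((le_abs_self _).trans_lt hlt') hx
  rw [Real.volume_Ioi, top_le_iff] at h2
  exact h1.ne h2

/-- The level set inequality on right half-lines. -/
lemma Calibrates.integral_Ioi_comp_mul_nonpos {f v z : ℝ → ℝ} (h : Calibrates f v z)
    (hf : Integrable f) {G : ℝ → ℝ} (hG : ContDiff ℝ 1 G) (hmono : Monotone G)
    (hG0 : ∀ s, 0 ≤ G s) (hG1 : ∀ s, G s ≤ 1) {l : ℝ} (hl : 0 < l) (hGl : ∀ s ≤ l, G s = 0)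
    (hint : Integrable fun x => G (f x) * v x) (a : ℝ) :
    ∫ x in Ioi a, G (f x) * v x ≤ 0 := by
  have hloc := hf.locallyIntegrable
  choose b hb using fun n : ℕ => exists_gt_lt_of_integrable hf hl (ae_tendsto_mollify hloc)
    (max a n)
  have hbt : Tendsto b atTop atTop :=
    tendsto_atTop_mono (fun n => (le_max_right a n).trans (hb n).1.le) tendsto_natCast_atTop_atTop
  refine le_of_tendsto (intervalIntegral_tendsto_integral_Ioi a hint.integrableOn hbt)
    (Eventually.of_forall fun n => ?_)
  exact h.intervalIntegral_comp_mul_nonpos hloc hG hmono hG0 hG1 hGl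
    ((le_max_left a n).trans (hb n).1.le) (Or.inr rfl) (hb n).2.1 (hb n).2.2

/-- The level set inequality: on the line and on half-lines, `∫ G(f) z' ≤ 0` for nondecreasing `G`
that vanish below a positive level. Heuristically `G(f)` is a superposition of indicators of
superlevel sets. Such a set has components `(p, q)` with `z(p) = 1`, unless `p` is the end point of
the half-line, and `z(q) = -1`; since `|z| ≤ 1`, the contribution `z(q) - z(p)` is nonpositive even
in the exceptional case (and likewise for left half-lines). -/
lemma Calibrates.setIntegral_comp_mul_nonpos {f v z : ℝ → ℝ} (h : Calibrates f v z)
    (hf : Integrable f) {G : ℝ → ℝ} (hG : ContDiff ℝ 1 G) (hmono : Monotone G)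
    (hG0 : ∀ s, 0 ≤ G s) (hG1 : ∀ s, G s ≤ 1) {l : ℝ} (hl : 0 < l) (hGl : ∀ s ≤ l, G s = 0)
    (hint : Integrable fun x => G (f x) * v x) {S : Set ℝ}
    (hS : S = univ ∨ (∃ a, S = Ioi a) ∨ ∃ a, S = Iio a) :
    ∫ x in S, G (f x) * v x ≤ 0 := by
  rcases hS with rfl | ⟨a, rfl⟩ | ⟨a, rfl⟩
  · have ht : Tendsto (fun n : ℕ => ∫ x in Ioi (-(n : ℝ)), G (f x) * v x) atTop
        (𝓝 (∫ x in univ, G (f x) * v x)) := by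
      have hU : (⋃ n : ℕ, Ioi (-(n : ℝ))) = univ := by
        ext x
        simp only [mem_iUnion, mem_Ioi, mem_univ, iff_true]
        obtain ⟨n, hn⟩ := exists_nat_gt (-x)
        exact ⟨n, by linarith⟩
      rw [← hU]
      refine tendsto_setIntegral_of_monotone (fun _ => measurableSet_Ioi) ?_ hint.integrableOn
      intro m n hmn
      exact Ioi_subset_Ioi (by simpa using hmn)
    exact le_of_tendsto ht (Eventually.of_forall fun n =>
      h.integral_Ioi_comp_mul_nonpos hf hG hmono hG0 hG1 hl hGl hint _)
  · exact h.integral_Ioi_comp_mul_nonpos hf hG hmono hG0 hG1 hl hGl hint a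
  · have := h.comp_neg.integral_Ioi_comp_mul_nonpos hf.comp_neg hG hmono hG0 hG1 hl hGl
      hint.comp_neg (-a)
    rw [integral_comp_neg_Ioi (-a) fun x => G (f x) * v x, neg_neg] at this
    rwa [← integral_Iic_eq_integral_Iio]

/-! ### The field outside the support -/

/-- A nonnegative integrable function that does not vanish on `(-∞, c)` increases somewhere there,
and the field equals `1` there. -/
lemma Calibrates.exists_lt_eq_one {f v z : ℝ → ℝ} (h : Calibrates f v z) (hf : Integrable f)
    (hf0 : ∀ᵐ x, 0 ≤ f x) {c : ℝ} (hc : ¬ ∀ᵐ x, x < c → f x = 0) : ∃ p < c, z p = 1 := by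
  have hloc := hf.locallyIntegrable
  have h1 : ∃ x, x < c ∧ 0 < f x ∧
      Tendsto (fun n => mollify (shrinkingBump n) f x) atTop (𝓝 (f x)) := by
    by_contra! hcon
    apply hc
    filter_upwards [hf0, ae_tendsto_mollify hloc] with x hx0 hx hxc
    by_contra hne
    exact hcon x hxc (lt_of_le_of_ne hx0 (Ne.symm hne)) hx
  obtain ⟨x, hxc, hfx, hx⟩ := h1
  have e1 : ∀ᶠ n in atTop, (shrinkingBump n).rOut < c - x :=
    tendsto_rOut_shrinkingBump.eventually (gt_mem_nhds (by linarith))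
  obtain ⟨n, hn1, hn2⟩ := (e1.and (hx.eventually (lt_mem_nhds hfx))).exists
  set F := mollify (shrinkingBump n) f with hF
  have hFd : Differentiable ℝ F := (contDiff_mollify _ hloc).differentiable (by norm_num)
  have hFi : Integrable F := by
    rw [hF, mollify_eq_convolution]
    exact ((shrinkingBump n).integrable_normed).integrable_convolution _ hf
  obtain ⟨y, hy1, hy2, -⟩ := exists_gt_lt_of_integrable hFi.comp_neg hn2
    (P := fun _ => True) (Eventually.of_forall fun _ => trivial) (-x)
  obtain ⟨w, hw, hw'⟩ := exists_deriv_eq_slope F (show -y < x by linarith)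
    hFd.continuous.continuousOn hFd.differentiableOn
  have hpos : 0 < deriv F w := by
    rw [hw']
    exact div_pos (by linarith) (by linarith)
  obtain ⟨p, hp, hzp⟩ := h.pos _ w hpos
  exact ⟨p, by linarith [(abs_lt.mp hp).2, hw.2], hzp⟩

/-- To the left of the support of a nonzero nonnegative profile the field equals `1`. The leftmost
point where `z = 1` has no mass of `f` to its left, so `v = 0` and `z` is constant there. -/
lemma Calibrates.eq_one_of_left {f v z : ℝ → ℝ} (h : Calibrates f v z) (hf : Integrable f)
    (hf0 : ∀ᵐ x, 0 ≤ f x) (hv : ∀ᵐ x, f x = 0 → v x = 0) (hne : ¬ f =ᵐ[volume] 0) {A : ℝ}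
    (hA : ∀ᵐ x, x < A → f x = 0) : z A = 1 := by
  have hconst : ∀ c, (∀ᵐ x, x < c → f x = 0) → ∀ p ≤ c, ∀ q ≤ c, z p = z q := by
    intro c hc
    have key : ∀ p ≤ c, z p = z c := by
      intro p hp
      have : z c - z p = 0 := by
        rw [h.sub_eq, intervalIntegral.integral_of_le hp, ← integral_Ico_eq_integral_Ioc]
        apply setIntegral_eq_zero_of_ae_eq_zero
        filter_upwards [hc, hv] with x hx1 hx2 hx3 using hx2 (hx1 hx3.2)
      linarith
    intro p hp q hq
    rw [key p hp, key q hq]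
  set P := {p | z p = 1} with hPdef
  have hPc : IsClosed P := isClosed_eq h.continuous continuous_const
  by_cases hlow : ∃ p ∈ P, p ≤ A
  · obtain ⟨p, hp, hpA⟩ := hlow
    rw [hconst A hA A le_rfl p hpA, hp]
  · push Not at hlow
    have hPn : P.Nonempty := by
      by_contra hPe
      apply hne
      have : ∀ n : ℕ, ∀ᵐ x, x < (n : ℝ) → f x = 0 := by
        intro n
        by_contra hn
        obtain ⟨p, -, hp⟩ := h.exists_lt_eq_one hf hf0 hn
        exact hPe ⟨p, hp⟩
      filter_upwards [ae_all_iff.mpr this] with x hx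
      obtain ⟨n, hn⟩ := exists_nat_gt x
      exact hx n hn
    have hbdd : BddBelow P := ⟨A, fun p hp => (hlow p hp).le⟩
    have ha : sInf P ∈ P := hPc.csInf_mem hPn hbdd
    have hzero : ∀ᵐ x, x < sInf P → f x = 0 := by
      by_contra hn
      obtain ⟨p, hp, hp'⟩ := h.exists_lt_eq_one hf hf0 hn
      exact absurd (csInf_le hbdd hp') (not_le.mpr hp)
    rw [hconst _ hzero A (hlow _ ha).le _ le_rfl, ha]

/-- If the nonzero nonnegative profile `f` is supported in `[A, B]`, the field drops from `1` to
`-1` across it. -/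
lemma Calibrates.sub_eq_neg_two {f v z : ℝ → ℝ} (h : Calibrates f v z) (hf : Integrable f)
    (hf0 : ∀ᵐ x, 0 ≤ f x) (hv : ∀ᵐ x, f x = 0 → v x = 0) (hne : ¬ f =ᵐ[volume] 0) {A B : ℝ}
    (hA : ∀ᵐ x, x < A → f x = 0) (hB : ∀ᵐ x, B < x → f x = 0) : z B - z A = -2 := by
  have hq : ∀ {P : ℝ → Prop}, (∀ᵐ x, P x) → ∀ᵐ x, P (-x) := fun hP =>
    (Measure.measurePreserving_neg volume).quasiMeasurePreserving.ae hP
  have h1 := h.eq_one_of_left hf hf0 hv hne hA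
  have h2 := h.comp_neg.eq_one_of_left hf.comp_neg (hq hf0) (hq hv) (A := -B) (fun h0 => hne ?_) ?_
  · simp only [neg_neg] at h2
    linarith
  · filter_upwards [hq h0] with x hx
    simpa using hx
  · filter_upwards [hq hB] with x hx hxB using hx (by linarith)

/-! ### Paths in time -/

lemma ae_swap_of_ae_prod {μ ν : Measure ℝ} [SFinite μ] [SFinite ν] {P : ℝ → ℝ → Prop}
    (h : ∀ᵐ p ∂μ.prod ν, P p.1 p.2) : ∀ᵐ y ∂ν, ∀ᵐ x ∂μ, P x y :=
  Measure.ae_ae_of_ae_prod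
    (Measure.measurePreserving_swap (μ := ν) (ν := μ) |>.quasiMeasurePreserving.ae h)

lemma ae_memLp_two_slice {μ ν : Measure ℝ} [SFinite μ] [SFinite ν] {F : ℝ → ℝ → ℝ}
    (h : MemLp (Function.uncurry F) 2 (μ.prod ν)) : ∀ᵐ x ∂μ, MemLp (F x) 2 ν := by
  filter_upwards [((memLp_two_iff_integrable_sq h.aestronglyMeasurable).mp h).prod_right_ae,
    h.aestronglyMeasurable.prodMk_left] with x h1 h2
  exact (memLp_two_iff_integrable_sq h2).mpr h1

lemma ae_memLp_two_slice_swap {μ ν : Measure ℝ} [SFinite μ] [SFinite ν] {F : ℝ → ℝ → ℝ}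
    (h : MemLp (Function.uncurry F) 2 (μ.prod ν)) : ∀ᵐ y ∂ν, MemLp (fun x => F x y) 2 μ :=
  ae_memLp_two_slice (F := fun y x => F x y)
    (h.comp_measurePreserving (Measure.measurePreserving_swap (μ := ν) (ν := μ)))

/-- For almost every `x`, the path `r ↦ w r x` agrees almost everywhere on `(0, T)`, and at `T`,
with the primitive of `v · x` started at `w 0 x`. The definition gives this for each time outside a
null set depending on that time; Fubini exchanges the two. -/
lemma HasTimeDerivL2.ae_eq_primitive {w v : ℝ → ℝ → ℝ} (h : HasTimeDerivL2 w v)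
    (hw : AEStronglyMeasurable (w 0)) {T : ℝ} (hT : 0 < T) :
    ∀ᵐ x, IntervalIntegrable (fun r => v r x) volume 0 T ∧
      (∀ᵐ r ∂volume.restrict (Ioo 0 T), w r x = w 0 x + ∫ q in (0 : ℝ)..r, v q x) ∧
      w T x = w 0 x + ∫ q in (0 : ℝ)..T, v q x := by
  obtain ⟨W, hWm, hW'⟩ := (h.memLp T hT).aestronglyMeasurable
  obtain ⟨V, hVm, hV'⟩ := (h.memLp_deriv T hT).aestronglyMeasurable
  have hW : ∀ᵐ p ∂(volume.restrict (Ioo 0 T)).prod volume, w p.1 p.2 = W p := hW'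
  have hV : ∀ᵐ p ∂(volume.restrict (Ioo 0 T)).prod volume, v p.1 p.2 = V p := hV'
  obtain ⟨W₀, hW₀m, hW₀⟩ := hw
  have hW2 := ae_swap_of_ae_prod (P := fun r x => w r x = W (r, x)) hW
  have hV2 := ae_swap_of_ae_prod (P := fun r x => v r x = V (r, x)) hV
  -- on `[0, T]` the primitives of `v · x` and of its measurable version agree
  have hprim : ∀ x, (∀ᵐ q ∂volume.restrict (Ioo 0 T), v q x = V (q, x)) → ∀ r ∈ Icc 0 T,
      ∫ q in (0 : ℝ)..r, v q x = ∫ q, (Ioc 0 r).indicator (fun q => V (q, x)) q := by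
    intro x hx r hr
    rw [integral_indicator measurableSet_Ioc, intervalIntegral.integral_of_le hr.1]
    apply integral_congr_ae
    have hx' : ∀ᵐ q ∂volume.restrict (Ioc 0 T), v q x = V (q, x) := by
      rwa [← restrict_Ioo_eq_restrict_Ioc]
    exact ae_restrict_of_ae_restrict_of_subset (Ioc_subset_Ioc_right hr.2) hx'
  have hΦ : StronglyMeasurable fun p : ℝ × ℝ =>
      ∫ q, (Ioc 0 p.1).indicator (fun q => V (q, p.2)) q := by
    apply StronglyMeasurable.integral_prod_right (f := fun (p : ℝ × ℝ) (q : ℝ) =>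
      (Ioc 0 p.1).indicator (fun q => V (q, p.2)) q)
    have hs : MeasurableSet {t : (ℝ × ℝ) × ℝ | 0 < t.2 ∧ t.2 ≤ t.1.1} :=
      (measurableSet_lt measurable_const measurable_snd).inter
        (measurableSet_le measurable_snd (measurable_fst.comp measurable_fst))
    have := (hVm.comp_measurable (measurable_snd.prodMk
      (measurable_snd.comp measurable_fst) : Measurable fun t : (ℝ × ℝ) × ℝ =>
        (t.2, t.1.2))).indicator hs
    exact this
  have hset : MeasurableSet {p : ℝ × ℝ | W (p.1, p.2) = W₀ p.2 +
      ∫ q, (Ioc 0 p.1).indicator (fun q => V (q, p.2)) q} :=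
    measurableSet_eq_fun hWm.measurable
      ((hW₀m.measurable.comp measurable_snd).add hΦ.measurable)
  have hmain : ∀ᵐ x, ∀ᵐ r ∂volume.restrict (Ioo 0 T), W (r, x) = W₀ x +
      ∫ q, (Ioc 0 r).indicator (fun q => V (q, x)) q := by
    rw [← Measure.ae_ae_comm (p := fun r x => W (r, x) = W₀ x +
      ∫ q, (Ioc 0 r).indicator (fun q => V (q, x)) q) hset]
    filter_upwards [Measure.ae_ae_of_ae_prod hW, ae_restrict_mem measurableSet_Ioo] with r hr hrT
    filter_upwards [hr, hW₀, hV2, h.integral_eq 0 r le_rfl hrT.1.le] with x h1 h2 h3 h4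
    rw [← h1, ← h2, ← hprim x h3 r ⟨hrT.1.le, hrT.2.le⟩]
    linarith
  filter_upwards [hmain, hW2, hV2, hW₀, h.integral_eq 0 T le_rfl hT.le,
    ae_memLp_two_slice_swap (h.memLp_deriv T hT)] with x h1 h2 h3 h4 h5 h6
  refine ⟨?_, ?_, by linarith⟩
  · rw [intervalIntegrable_iff_integrableOn_Ioo_of_le hT.le]
    exact h6.integrable (by norm_num)
  · filter_upwards [h1, h2, ae_restrict_mem measurableSet_Ioo] with r hr1 hr2 hrT
    rw [hr2, hr1, h4, hprim x h3 r ⟨hrT.1.le, hrT.2.le⟩]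

/-- Composition with a Lipschitz function preserves absolute continuity. -/
lemma _root_.LipschitzWith.comp_absolutelyContinuousOnInterval {H y : ℝ → ℝ} {a b : ℝ}
    (hH : LipschitzWith 1 H) (hy : AbsolutelyContinuousOnInterval y a b) :
    AbsolutelyContinuousOnInterval (fun r => H (y r)) a b := by
  rw [absolutelyContinuousOnInterval_iff] at hy ⊢
  intro ε hε
  obtain ⟨δ, hδ, hE⟩ := hy ε hε
  refine ⟨δ, hδ, fun E hEm hEs => (Finset.sum_le_sum fun i _ => ?_).trans_lt (hE E hEm hEs)⟩
  simpa using hH.dist_le_mul (y (E.2 i).1) (y (E.2 i).2)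

/-- Chain rule along the paths of `ae_eq_primitive`. -/
lemma HasTimeDerivL2.ae_comp_sub_eq {w v : ℝ → ℝ → ℝ} (h : HasTimeDerivL2 w v)
    (hw : AEStronglyMeasurable (w 0)) {T : ℝ} (hT : 0 < T) {H G : ℝ → ℝ}
    (hH : LipschitzWith 1 H) (hHG : ∀ s, HasDerivAt H (G s) s) :
    ∀ᵐ x, H (w T x) - H (w 0 x) = ∫ r in Ioo 0 T, G (w r x) * v r x := by
  filter_upwards [h.ae_eq_primitive hw hT] with x ⟨hi, hr, hTx⟩
  set y := fun r => w 0 x + ∫ q in (0 : ℝ)..r, v q x with hy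
  have hy0 : y 0 = w 0 x := by simp [hy]
  have hac : AbsolutelyContinuousOnInterval y 0 T :=
    absolutelyContinuousOnInterval_of_sub_eq hi fun r => by rw [hy0]; simp [hy]
  have hyT : w T x = y T := hTx
  rw [hyT, ← hy0]
  rw [← (hH.comp_absolutelyContinuousOnInterval hac).integral_deriv_eq_sub,
    intervalIntegral.integral_of_le hT.le, integral_Ioc_eq_integral_Ioo]
  apply integral_congr_ae
  filter_upwards [hr, ae_restrict_of_ae hi.ae_hasDerivAt_integral,
    ae_restrict_mem measurableSet_Ioo] with r h1 h2 h3
  have h3' : r ∈ uIcc 0 T := by rw [uIcc_of_le hT.le]; exact Ioo_subset_Icc_self h3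
  have hd : HasDerivAt y (v r x) r := (h2 h3' 0 left_mem_uIcc).const_add _
  have hd' : HasDerivAt (fun r => H (y r)) (G (y r) * v r x) r := (hHG (y r)).comp r hd
  rw [hd'.deriv, h1]

/-- Where a nonnegative solution vanishes it is minimal in time, so its time derivative vanishes. -/
lemma HasTimeDerivL2.ae_deriv_eq_zero {w v : ℝ → ℝ → ℝ} (h : HasTimeDerivL2 w v)
    (hw : AEStronglyMeasurable (w 0)) (hw0 : ∀ t, 0 ≤ t → ∀ᵐ x, 0 ≤ w t x) {T : ℝ} (hT : 0 < T) :
    ∀ᵐ r ∂volume.restrict (Ioo 0 T), ∀ᵐ x, w r x = 0 → v r x = 0 := by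
  obtain ⟨W, hWm, hW'⟩ := (h.memLp T hT).aestronglyMeasurable
  obtain ⟨V, hVm, hV'⟩ := (h.memLp_deriv T hT).aestronglyMeasurable
  have hW : ∀ᵐ p ∂(volume.restrict (Ioo 0 T)).prod volume, w p.1 p.2 = W p := hW'
  have hV : ∀ᵐ p ∂(volume.restrict (Ioo 0 T)).prod volume, v p.1 p.2 = V p := hV'
  have hW2 := ae_swap_of_ae_prod (P := fun r x => w r x = W (r, x)) hW
  have hV2 := ae_swap_of_ae_prod (P := fun r x => v r x = V (r, x)) hV
  have hnn : ∀ᵐ x, ∀ᵐ r ∂volume.restrict (Ioo 0 T), 0 ≤ W (r, x) := by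
    rw [← Measure.ae_ae_comm (p := fun r x => 0 ≤ W (r, x))
      (measurableSet_le measurable_const hWm.measurable)]
    filter_upwards [Measure.ae_ae_of_ae_prod hW, ae_restrict_mem measurableSet_Ioo] with r hr hrT
    filter_upwards [hr, hw0 r hrT.1.le] with x h1 h2
    rwa [← h1]
  have hset : MeasurableSet {p : ℝ × ℝ | W (p.1, p.2) = 0 → V (p.1, p.2) = 0} :=
    (measurableSet_eq_fun hWm.measurable measurable_const).imp
      (measurableSet_eq_fun hVm.measurable measurable_const)
  have hmain : ∀ᵐ r ∂volume.restrict (Ioo 0 T), ∀ᵐ x, W (r, x) = 0 → V (r, x) = 0 := by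
    rw [Measure.ae_ae_comm (p := fun r x => W (r, x) = 0 → V (r, x) = 0) hset]
    filter_upwards [h.ae_eq_primitive hw hT, hW2, hV2, hnn] with x ⟨hi, hr, _⟩ h2 h3 h4
    set y := fun r => w 0 x + ∫ q in (0 : ℝ)..r, v q x with hy
    have hyc : ContinuousOn y (Ioo 0 T) := by
      have := intervalIntegral.continuousOn_primitive_interval'
        (hi : IntervalIntegrable (fun r => v r x) volume 0 T) left_mem_uIcc
      rw [uIcc_of_le hT.le] at this
      exact (continuousOn_const.add this).mono Ioo_subset_Icc_self
    have hy0 : ∀ r ∈ Ioo 0 T, 0 ≤ y r := by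
      have hopen : IsOpen (Ioo 0 T ∩ y ⁻¹' Iio 0) := hyc.isOpen_inter_preimage isOpen_Ioo isOpen_Iio
      have hnull : volume (Ioo 0 T ∩ y ⁻¹' Iio 0) = 0 := by
        have hae : ∀ᵐ r, r ∈ Ioo 0 T → 0 ≤ y r := by
          rw [← ae_restrict_iff' measurableSet_Ioo]
          filter_upwards [hr, h2, h4] with r e1 e2 e4
          change 0 ≤ w 0 x + _
          rwa [← e1, e2]
        refine measure_mono_null ?_ (ae_iff.mp hae)
        intro r hr'
        simp only [mem_ofPred_eq, not_forall, not_le]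
        exact ⟨hr'.1, hr'.2⟩
      have hempty := (hopen.measure_eq_zero_iff volume).mp hnull
      intro r hrT
      by_contra hlt
      have : r ∈ Ioo 0 T ∩ y ⁻¹' Iio 0 := ⟨hrT, not_le.mp hlt⟩
      rw [hempty] at this
      exact this
    filter_upwards [hr, h2, h3, ae_restrict_of_ae hi.ae_hasDerivAt_integral,
      ae_restrict_mem measurableSet_Ioo] with r e1 e2 e3 e4 hrT hzero
    have hrT' : r ∈ uIcc 0 T := by rw [uIcc_of_le hT.le]; exact Ioo_subset_Icc_self hrT
    have hd : HasDerivAt y (v r x) r := (e4 hrT' 0 left_mem_uIcc).const_add _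
    have hyr : y r = 0 := by
      change w 0 x + _ = 0
      rw [← e1, e2, hzero]
    have hmin : IsLocalMin y r := by
      filter_upwards [isOpen_Ioo.mem_nhds hrT] with q hq
      rw [hyr]
      exact hy0 q hq
    rw [← e3]
    exact hmin.hasDerivAt_eq_zero hd
  filter_upwards [hmain, Measure.ae_ae_of_ae_prod hW, Measure.ae_ae_of_ae_prod hV] with r h1 h2 h3
  filter_upwards [h1, h2, h3] with x e1 e2 e3
  intro h0
  exact e3.trans (e1 (e2.symm.trans h0))

/-! ### Monotonicity of the excess over a level -/

/-- For `l > 0`, a smooth nondecreasing function with values in `[0, 1]` that vanishes exactly on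
`(-∞, l]`. -/
noncomputable def levelGate (l s : ℝ) : ℝ := Real.smoothTransition (s / l - 1)

/-- The primitive of `levelGate l`, a smooth substitute for `s ↦ max (s - l) 0`. -/
noncomputable def levelExcess (l s : ℝ) : ℝ := ∫ q in (0 : ℝ)..s, levelGate l q

section LevelGate

variable {l : ℝ}

lemma contDiff_levelGate (l : ℝ) : ContDiff ℝ 1 (levelGate l) :=
  Real.smoothTransition.contDiff.comp ((contDiff_id.div_const l).sub contDiff_const)

lemma levelGate_nonneg (l s : ℝ) : 0 ≤ levelGate l s := Real.smoothTransition.nonneg _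

lemma levelGate_le_one (l s : ℝ) : levelGate l s ≤ 1 := Real.smoothTransition.le_one _

lemma monotone_levelGate (hl : 0 < l) : Monotone (levelGate l) := fun _ _ hab =>
  Real.smoothTransition.monotone (sub_le_sub_right (div_le_div_of_nonneg_right hab hl.le) 1)

lemma levelGate_eq_zero (hl : 0 < l) {s : ℝ} (hs : s ≤ l) : levelGate l s = 0 :=
  Real.smoothTransition.zero_of_nonpos (by rw [sub_nonpos]; exact (div_le_one hl).mpr hs)

lemma levelGate_pos (hl : 0 < l) {s : ℝ} (hs : l < s) : 0 < levelGate l s :=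
  Real.smoothTransition.pos_of_pos (by rw [sub_pos]; exact (one_lt_div hl).mpr hs)

lemma abs_levelGate_le (hl : 0 < l) (s : ℝ) : |levelGate l s| ≤ l⁻¹ * |s| := by
  rw [abs_of_nonneg (levelGate_nonneg _ _)]
  rcases le_or_gt s l with hs | hs
  · rw [levelGate_eq_zero hl hs]; positivity
  · refine (levelGate_le_one _ _).trans ?_
    rw [inv_mul_eq_div, one_le_div hl]
    exact hs.le.trans (le_abs_self _)

lemma hasDerivAt_levelExcess (l s : ℝ) : HasDerivAt (levelExcess l) (levelGate l s) s :=
  (contDiff_levelGate l).continuous.integral_hasStrictDerivAt 0 s |>.hasDerivAt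

lemma lipschitzWith_levelExcess (l : ℝ) : LipschitzWith 1 (levelExcess l) := by
  refine lipschitzWith_of_nnnorm_deriv_le
    (fun s => (hasDerivAt_levelExcess l s).differentiableAt) fun s => ?_
  rw [(hasDerivAt_levelExcess l s).deriv, ← NNReal.coe_le_coe, coe_nnnorm, Real.norm_eq_abs,
    abs_of_nonneg (levelGate_nonneg _ _)]
  exact levelGate_le_one _ _

lemma levelExcess_eq_zero (hl : 0 < l) {s : ℝ} (hs : s ≤ l) : levelExcess l s = 0 := by
  apply intervalIntegral.integral_zero_ae
  refine Eventually.of_forall fun q hq => levelGate_eq_zero hl ?_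
  rcases mem_uIoc.mp hq with h | h
  · exact h.2.trans hs
  · exact h.2.trans hl.le

lemma levelExcess_pos (hl : 0 < l) {s : ℝ} (hs : l < s) : 0 < levelExcess l s := by
  have hc := (contDiff_levelGate l).continuous
  have h1 : levelExcess l s = ∫ q in l..s, levelGate l q := by
    rw [← zero_add (∫ q in l..s, levelGate l q), ← levelExcess_eq_zero hl le_rfl]
    exact (intervalIntegral.integral_add_adjacent_intervals (hc.intervalIntegrable _ _)
      (hc.intervalIntegrable _ _)).symm
  rw [h1]
  exact intervalIntegral.intervalIntegral_pos_of_pos_on (hc.intervalIntegrable _ _)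
    (fun q hq => levelGate_pos hl hq.1) hs

lemma levelExcess_nonneg (hl : 0 < l) (s : ℝ) : 0 ≤ levelExcess l s := by
  rcases le_or_gt s l with hs | hs
  · rw [levelExcess_eq_zero hl hs]
  · exact (levelExcess_pos hl hs).le

lemma abs_levelExcess_sub_le (l a b : ℝ) : |levelExcess l a - levelExcess l b| ≤ |a - b| := by
  simpa [Real.dist_eq] using (lipschitzWith_levelExcess l).dist_le_mul a b

lemma integrable_levelExcess (hl : 0 < l) {f : ℝ → ℝ} (hf : Integrable f) :
    Integrable fun x => levelExcess l (f x) := by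
  refine hf.mono ((lipschitzWith_levelExcess l).continuous.comp_aestronglyMeasurable hf.1)
    (Eventually.of_forall fun x => ?_)
  have := abs_levelExcess_sub_le l (f x) 0
  rwa [levelExcess_eq_zero hl hl.le, sub_zero, sub_zero] at this

end LevelGate

/-- The excess over a positive level does not grow along the flow, on the line and on half-lines:
its time derivative is the integral in `Calibrates.setIntegral_comp_mul_nonpos`. -/
lemma HasTimeDerivL2.integral_levelExcess_le {w v : ℝ → ℝ → ℝ} (h : HasTimeDerivL2 w v)
    (hw : ∀ t, 0 ≤ t → Integrable (w t))
    (hcal : ∀ᵐ t ∂volume.restrict (Ioi (0 : ℝ)), ∃ z, Calibrates (w t) (v t) z)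
    {S : Set ℝ} (hS : S = univ ∨ (∃ a, S = Ioi a) ∨ ∃ a, S = Iio a) {l : ℝ} (hl : 0 < l)
    {T : ℝ} (hT : 0 < T) :
    ∫ x in S, levelExcess l (w T x) ≤ ∫ x in S, levelExcess l (w 0 x) := by
  have hcal' : ∀ᵐ t ∂volume.restrict (Ioo 0 T), ∃ z, Calibrates (w t) (v t) z :=
    ae_restrict_of_ae_restrict_of_subset Ioo_subset_Ioi_self hcal
  have hint : Integrable (Function.uncurry fun r x => levelGate l (w r x) * v r x)
      ((volume.restrict (Ioo 0 T)).prod volume) := by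
    have h1 : MemLp (fun p : ℝ × ℝ => levelGate l (Function.uncurry w p)) 2
        ((volume.restrict (Ioo 0 T)).prod volume) :=
      MemLp.of_le_mul (h.memLp T hT) ((contDiff_levelGate l).continuous.comp_aestronglyMeasurable
        (h.memLp T hT).aestronglyMeasurable) (Eventually.of_forall fun p => abs_levelGate_le hl _)
    exact h1.integrable_mul (h.memLp_deriv T hT)
  have hintS : Integrable (Function.uncurry fun r x => levelGate l (w r x) * v r x)
      ((volume.restrict (Ioo 0 T)).prod (volume.restrict S)) :=
    hint.mono_measure (Measure.prod_mono le_rfl Measure.restrict_le_self)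
  have hslice := hint.prod_right_ae
  rw [← sub_nonpos, ← integral_sub (integrable_levelExcess hl (hw T hT.le)).integrableOn
    (integrable_levelExcess hl (hw 0 le_rfl)).integrableOn]
  have heq : ∫ x in S, (levelExcess l (w T x) - levelExcess l (w 0 x))
      = ∫ x in S, ∫ r in Ioo 0 T, levelGate l (w r x) * v r x :=
    integral_congr_ae (ae_restrict_of_ae (h.ae_comp_sub_eq (hw 0 le_rfl).1 hT
      (lipschitzWith_levelExcess l) (hasDerivAt_levelExcess l)))
  rw [heq, ← integral_integral_swap hintS]
  apply integral_nonpos_of_ae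
  filter_upwards [hcal', hslice, ae_restrict_mem measurableSet_Ioo] with r ⟨z, hz⟩ hi hr
  exact hz.setIntegral_comp_mul_nonpos (hw r hr.1.le) (contDiff_levelGate l)
    (monotone_levelGate hl) (levelGate_nonneg l) (levelGate_le_one l) hl
    (fun s hs => levelGate_eq_zero hl hs) hi hS

/-! ### Maximum principle -/

/-- What the argument retains of a solution of the Cauchy problem: an integrable function at each
time, `L¹`-continuity at the initial time, and from every positive time on a time derivative whose
slices are calibrated. Contrary to `IsCauchySolution` it involves no measures. -/
structure IsCalibratedFlow (u : ℝ → ℝ → ℝ) : Prop where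
  integrable : ∀ t, 0 ≤ t → Integrable (u t)
  continuous_zero : Tendsto (fun s => ∫ x, |u s x - u 0 x|) (𝓝[>] 0) (𝓝 0)
  calibrated : ∀ τ, 0 < τ → ∃ v : ℝ → ℝ → ℝ, HasTimeDerivL2 (fun t => u (τ + t)) v ∧
    ∀ᵐ t ∂volume.restrict (Ioi (0 : ℝ)), ∃ z, Calibrates (u (τ + t)) (v t) z

lemma HasTimeDerivL2.ae_memLp_deriv {w v : ℝ → ℝ → ℝ} (h : HasTimeDerivL2 w v) :
    ∀ᵐ t ∂volume.restrict (Ioi (0 : ℝ)), MemLp (v t) 2 := by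
  have hU : Ioi (0 : ℝ) = ⋃ n : ℕ, Ioo 0 ((n : ℝ) + 1) := by
    ext x
    simp only [mem_Ioi, mem_iUnion, mem_Ioo, exists_and_left]
    refine ⟨fun hx => ⟨hx, ?_⟩, fun hx => hx.1⟩
    obtain ⟨n, hn⟩ := exists_nat_gt x
    exact ⟨n, by linarith⟩
  rw [hU, ae_restrict_iUnion_iff]
  exact fun n => ae_memLp_two_slice (h.memLp_deriv _ (by positivity))

lemma IsCauchySolution.isCalibratedFlow {u₀ : ℝ → ℝ} {u : ℝ → ℝ → ℝ} (h : IsCauchySolution u₀ u) :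
    IsCalibratedFlow u := by
  refine ⟨h.integrable, (h.continuous 0 le_rfl).mono_left
    (nhdsWithin_mono _ Ioi_subset_Ici_self), fun τ hτ => ?_⟩
  obtain ⟨v, z, hv, -, hz⟩ := (h.strong τ hτ).exists_field
  refine ⟨v, hv, ?_⟩
  filter_upwards [hz, hv.ae_memLp_deriv] with t ⟨h1, h2, μ, h3, h4⟩ h5
  exact ⟨z t, h3.calibrates h5 h1 h2 h4⟩

lemma IsCalibratedFlow.neg {u : ℝ → ℝ → ℝ} (h : IsCalibratedFlow u) :
    IsCalibratedFlow fun t x => -u t x := by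
  refine ⟨fun t ht => (h.integrable t ht).neg, ?_, fun τ hτ => ?_⟩
  · refine h.continuous_zero.congr fun s => integral_congr_ae (Eventually.of_forall fun x => ?_)
    simp only
    rw [← abs_neg]
    congr 1
    ring
  · obtain ⟨v, hv, hcal⟩ := h.calibrated τ hτ
    refine ⟨fun t x => -v t x, ⟨fun T hT => (hv.memLp T hT).neg,
      fun T hT => (hv.memLp_deriv T hT).neg, fun s t hs hst => ?_⟩, ?_⟩
    · filter_upwards [hv.integral_eq s t hs hst] with x hx
      rw [intervalIntegral.integral_neg, ← hx]
      ring
    · filter_upwards [hcal] with t ⟨z, hz⟩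
      exact ⟨_, hz.negate⟩

/-- Maximum principle on the line and on half-lines: a solution that is nonpositive initially stays
so. No boundary condition at the end point of a half-line is needed. The comparison is made at
positive levels `l`, where the superlevel sets have finite measure, and then `l → 0`. -/
lemma IsCalibratedFlow.ae_nonpos {u : ℝ → ℝ → ℝ} (h : IsCalibratedFlow u) {S : Set ℝ}
    (hS : S = univ ∨ (∃ a, S = Ioi a) ∨ ∃ a, S = Iio a)
    (h0 : ∀ᵐ x, x ∈ S → u 0 x ≤ 0) {t : ℝ} (ht : 0 ≤ t) : ∀ᵐ x, x ∈ S → u t x ≤ 0 := by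
  rcases ht.eq_or_lt with rfl | ht
  · exact h0
  have hSm : MeasurableSet S := by
    rcases hS with rfl | ⟨a, rfl⟩ | ⟨a, rfl⟩ <;> measurability
  have hlevel : ∀ l, 0 < l → ∀ᵐ x, x ∈ S → u t x ≤ l := by
    intro l hl
    have hzero : ∀ᵐ x ∂volume.restrict S, levelExcess l (u 0 x) = 0 := by
      rw [ae_restrict_iff' hSm]
      filter_upwards [h0] with x hx hxS using levelExcess_eq_zero hl ((hx hxS).trans hl.le)
    have hmono : ∀ τ, 0 < τ → τ < t →
        ∫ x in S, levelExcess l (u t x) ≤ ∫ x in S, levelExcess l (u τ x) := by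
      intro τ hτ hτt
      obtain ⟨v, hv, hcal⟩ := h.calibrated τ hτ
      have := hv.integral_levelExcess_le (fun s hs => h.integrable _ (by linarith)) hcal hS hl
        (T := t - τ) (by linarith)
      simpa using this
    have hbound : ∀ τ, 0 < τ → ∫ x in S, levelExcess l (u τ x) ≤ ∫ x, |u τ x - u 0 x| := by
      intro τ hτ
      have hi : Integrable fun x => |u τ x - u 0 x| :=
        ((h.integrable τ hτ.le).sub (h.integrable 0 le_rfl)).abs
      refine (integral_mono_ae (integrable_levelExcess hl (h.integrable τ hτ.le)).integrableOn
        hi.integrableOn ?_).trans (setIntegral_le_integral hi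
          (Eventually.of_forall fun x => abs_nonneg _))
      filter_upwards [hzero] with x hx
      have := abs_levelExcess_sub_le l (u τ x) (u 0 x)
      rw [hx, sub_zero] at this
      exact (le_abs_self _).trans this
    have hle : ∫ x in S, levelExcess l (u t x) ≤ 0 := by
      refine ge_of_tendsto h.continuous_zero ?_
      filter_upwards [Ioo_mem_nhdsGT ht] with τ hτ
      exact (hmono τ hτ.1 hτ.2).trans (hbound τ hτ.1)
    have hnn : ∀ x, 0 ≤ levelExcess l (u t x) := fun x => levelExcess_nonneg hl _
    have heq := (integral_eq_zero_iff_of_nonneg hnn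
      (integrable_levelExcess hl (h.integrable t ht.le)).integrableOn).mp
      (le_antisymm hle (integral_nonneg hnn))
    rw [← ae_restrict_iff' hSm]
    filter_upwards [heq] with x hx
    by_contra hlt
    exact (levelExcess_pos hl (not_le.mp hlt)).ne' hx
  filter_upwards [ae_all_iff.mpr fun n : ℕ => hlevel (1 / ((n : ℝ) + 1)) (by positivity)]
    with x hx hxS
  exact ge_of_tendsto' tendsto_one_div_add_atTop_nhds_zero_nat fun n => hx n hxS

lemma IsCalibratedFlow.ae_nonneg {u : ℝ → ℝ → ℝ} (h : IsCalibratedFlow u) {S : Set ℝ}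
    (hS : S = univ ∨ (∃ a, S = Ioi a) ∨ ∃ a, S = Iio a)
    (h0 : ∀ᵐ x, x ∈ S → 0 ≤ u 0 x) {t : ℝ} (ht : 0 ≤ t) : ∀ᵐ x, x ∈ S → 0 ≤ u t x := by
  have := h.neg.ae_nonpos hS (by filter_upwards [h0] with x hx hxS; simpa using hx hxS) ht
  filter_upwards [this] with x hx hxS
  simpa using hx hxS

lemma IsCalibratedFlow.ae_eq_zero {u : ℝ → ℝ → ℝ} (h : IsCalibratedFlow u) {S : Set ℝ}
    (hS : S = univ ∨ (∃ a, S = Ioi a) ∨ ∃ a, S = Iio a)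
    (h0 : ∀ᵐ x, x ∈ S → u 0 x = 0) {t : ℝ} (ht : 0 ≤ t) : ∀ᵐ x, x ∈ S → u t x = 0 := by
  filter_upwards [h.ae_nonpos hS (by filter_upwards [h0] with x hx hxS using (hx hxS).le) ht,
    h.ae_nonneg hS (by filter_upwards [h0] with x hx hxS using (hx hxS).ge) ht] with x h1 h2 hxS
  exact le_antisymm (h1 hxS) (h2 hxS)

/-! ### Mass and extinction -/

/-- Between positive times the mass is the integral of the rate `z(B) - z(A)`, which is `-2` as long
as the solution is not zero, and `0` afterwards. -/
lemma IsCalibratedFlow.exists_rate {u : ℝ → ℝ → ℝ} (h : IsCalibratedFlow u)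
    (hnn : ∀ t, 0 ≤ t → ∀ᵐ x, 0 ≤ u t x) {A B : ℝ} (hAB : A ≤ B)
    (hA : ∀ t, 0 ≤ t → ∀ᵐ x, x < A → u t x = 0) (hB : ∀ t, 0 ≤ t → ∀ᵐ x, B < x → u t x = 0)
    {τ t : ℝ} (hτ : 0 < τ) (hτt : τ < t) :
    ∃ k : ℝ → ℝ, IntegrableOn k (Ioo 0 (t - τ)) ∧
      (∀ᵐ r ∂volume.restrict (Ioo 0 (t - τ)),
        (u (τ + r) =ᵐ[volume] 0 ∧ k r = 0) ∨ (¬ u (τ + r) =ᵐ[volume] 0 ∧ k r = -2)) ∧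
      (∫ x, u t x) - ∫ x, u τ x = ∫ r in Ioo 0 (t - τ), k r := by
  have hT : 0 < t - τ := by linarith
  obtain ⟨v, hv, hcal⟩ := h.calibrated τ hτ
  have hw0 : ∀ s, 0 ≤ s → Integrable (u (τ + s)) := fun s hs => h.integrable _ (by linarith)
  have hint : Integrable (Function.uncurry v)
      ((volume.restrict (Ioo 0 (t - τ))).prod (volume.restrict (Ioc A B))) :=
    ((hv.memLp_deriv _ hT).mono_measure
      (Measure.prod_mono le_rfl Measure.restrict_le_self)).integrable (by norm_num)
  refine ⟨fun r => ∫ x in Ioc A B, v r x, hint.integral_prod_left, ?_, ?_⟩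
  · have hcal' := ae_restrict_of_ae_restrict_of_subset
      (Ioo_subset_Ioi_self : Ioo 0 (t - τ) ⊆ Ioi 0) hcal
    have hvz := hv.ae_deriv_eq_zero (hw0 0 le_rfl).1 (fun s hs => hnn _ (by linarith)) hT
    filter_upwards [hcal', hvz, ae_restrict_mem measurableSet_Ioo] with r ⟨z, hz⟩ hr0 hr
    have hpos : 0 ≤ τ + r := by linarith [hr.1]
    by_cases hzero : u (τ + r) =ᵐ[volume] 0
    · left
      refine ⟨hzero, integral_eq_zero_of_ae (ae_restrict_of_ae ?_)⟩
      filter_upwards [hzero, hr0] with x h1 h2 using h2 h1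
    · right
      refine ⟨hzero, ?_⟩
      rw [← intervalIntegral.integral_of_le hAB, ← hz.sub_eq]
      exact hz.sub_eq_neg_two (h.integrable _ hpos) (hnn _ hpos) hr0 hzero (hA _ hpos) (hB _ hpos)
  · have hloc : ∀ s, 0 ≤ s → ∫ x, u s x = ∫ x in Ioc A B, u s x := by
      intro s hs
      rw [← integral_Icc_eq_integral_Ioc]
      refine (setIntegral_eq_integral_of_ae_compl_eq_zero ?_).symm
      filter_upwards [hA s hs, hB s hs] with x h1 h2 hx
      rw [mem_Icc, not_and_or, not_le, not_le] at hx
      exact hx.elim h1 h2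
    rw [hloc t (by linarith), hloc τ hτ.le, ← integral_sub (h.integrable t (by linarith)).integrableOn
      (h.integrable τ hτ.le).integrableOn, integral_integral_swap hint]
    apply integral_congr_ae
    filter_upwards [ae_restrict_of_ae (hv.integral_eq 0 (t - τ) le_rfl hT.le)] with x hx
    rw [intervalIntegral.integral_of_le hT.le, integral_Ioc_eq_integral_Ioo] at hx
    simpa using hx

/-- The mass does not increase, decreases at rate at most `2`, and at rate exactly `2` as long as
the solution is not zero. -/
lemma IsCalibratedFlow.mass_bounds {u : ℝ → ℝ → ℝ} (h : IsCalibratedFlow u)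
    (hnn : ∀ t, 0 ≤ t → ∀ᵐ x, 0 ≤ u t x) {A B : ℝ} (hAB : A ≤ B)
    (hA : ∀ t, 0 ≤ t → ∀ᵐ x, x < A → u t x = 0) (hB : ∀ t, 0 ≤ t → ∀ᵐ x, B < x → u t x = 0)
    {τ t : ℝ} (hτ : 0 < τ) (hτt : τ < t) :
    ∫ x, u t x ≤ ∫ x, u τ x ∧ (∫ x, u τ x) - 2 * (t - τ) ≤ ∫ x, u t x ∧
      ((∀ r ∈ Ioo τ t, ¬ u r =ᵐ[volume] 0) → ∫ x, u t x = (∫ x, u τ x) - 2 * (t - τ)) := by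
  obtain ⟨k, hki, hk, hsub⟩ := h.exists_rate hnn hAB hA hB hτ hτt
  have hconst : ∫ _ in Ioo 0 (t - τ), (-2 : ℝ) = -2 * (t - τ) := by
    rw [setIntegral_const, Real.volume_real_Ioo_of_le (by linarith), sub_zero, smul_eq_mul]
    ring
  have h1 : ∫ r in Ioo 0 (t - τ), k r ≤ 0 := by
    apply integral_nonpos_of_ae
    filter_upwards [hk] with r hr
    rcases hr with ⟨_, hr⟩ | ⟨_, hr⟩ <;> simp [hr]
  have h2 : -2 * (t - τ) ≤ ∫ r in Ioo 0 (t - τ), k r := by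
    rw [← hconst]
    refine integral_mono_ae (integrable_const _) hki ?_
    filter_upwards [hk] with r hr
    rcases hr with ⟨_, hr⟩ | ⟨_, hr⟩ <;> simp [hr]
  refine ⟨by linarith, by linarith, fun hne => ?_⟩
  have h3 : ∫ r in Ioo 0 (t - τ), k r = -2 * (t - τ) := by
    rw [← hconst]
    apply integral_congr_ae
    filter_upwards [hk, ae_restrict_mem measurableSet_Ioo] with r hr hrT
    rcases hr with ⟨hr, _⟩ | ⟨_, hr⟩
    · exact absurd hr (hne _ ⟨by linarith [hrT.1], by linarith [hrT.2]⟩)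
    · exact hr
  linarith

lemma IsCalibratedFlow.tendsto_mass_zero {u : ℝ → ℝ → ℝ} (h : IsCalibratedFlow u) :
    Tendsto (fun s => ∫ x, u s x) (𝓝[>] 0) (𝓝 (∫ x, u 0 x)) := by
  rw [tendsto_iff_dist_tendsto_zero]
  refine squeeze_zero' (Eventually.of_forall fun _ => dist_nonneg) ?_ h.continuous_zero
  filter_upwards [self_mem_nhdsWithin] with s hs
  rw [Real.dist_eq, ← integral_sub (h.integrable s (le_of_lt hs)) (h.integrable 0 le_rfl)]
  exact abs_integral_le_integral_abs

/-- A nonnegative solution supported in a fixed bounded interval loses mass at rate `2` until its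
mass is used up, and is zero afterwards. -/
lemma IsCalibratedFlow.mass_eq_max {u : ℝ → ℝ → ℝ} (h : IsCalibratedFlow u)
    (hnn : ∀ t, 0 ≤ t → ∀ᵐ x, 0 ≤ u t x) {A B : ℝ} (hAB : A ≤ B)
    (hA : ∀ t, 0 ≤ t → ∀ᵐ x, x < A → u t x = 0) (hB : ∀ t, 0 ≤ t → ∀ᵐ x, B < x → u t x = 0)
    {t : ℝ} (ht : 0 ≤ t) : ∫ x, u t x = max ((∫ x, u 0 x) - 2 * t) 0 := by
  have hM0 : ∀ s, 0 ≤ s → 0 ≤ ∫ x, u s x := fun s hs => integral_nonneg_of_ae (hnn s hs)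
  rcases ht.eq_or_lt with rfl | ht
  · rw [mul_zero, sub_zero, max_eq_left (hM0 0 le_rfl)]
  have hτ : ∀ᶠ τ in 𝓝[>] (0 : ℝ), τ ∈ Ioo 0 t := Ioo_mem_nhdsGT ht
  have hlim : Tendsto (fun τ => (∫ x, u τ x) - 2 * (t - τ)) (𝓝[>] 0) (𝓝 ((∫ x, u 0 x) - 2 * t)) := by
    have h1 : Tendsto (fun τ : ℝ => 2 * (t - τ)) (𝓝[>] 0) (𝓝 (2 * (t - 0))) :=
      ((continuous_const.mul (continuous_const.sub continuous_id)).tendsto 0).mono_left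
        nhdsWithin_le_nhds
    rw [sub_zero] at h1
    exact h.tendsto_mass_zero.sub h1
  have hlow : (∫ x, u 0 x) - 2 * t ≤ ∫ x, u t x := by
    refine le_of_tendsto hlim ?_
    filter_upwards [hτ] with τ hτ using (h.mass_bounds hnn hAB hA hB hτ.1 hτ.2).2.1
  rcases (hM0 t ht.le).eq_or_lt with hz | hpos
  · rw [← hz, max_eq_right (by linarith)]
  · -- by monotonicity the mass is positive at all earlier times, so the rate is `-2` throughout
    have hne : ∀ r ∈ Ioo 0 t, ¬ u r =ᵐ[volume] 0 := by
      intro r hr hzero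
      have h1 := (h.mass_bounds hnn hAB hA hB hr.1 hr.2).1
      rw [integral_eq_zero_of_ae hzero] at h1
      linarith
    have heq : ∫ x, u t x = (∫ x, u 0 x) - 2 * t := by
      refine tendsto_nhds_unique_of_eventuallyEq tendsto_const_nhds hlim ?_
      filter_upwards [hτ] with τ hτ
      exact (h.mass_bounds hnn hAB hA hB hτ.1 hτ.2).2.2
        fun r hr => hne r ⟨hτ.1.trans hr.1, hr.2⟩
    rw [← heq, max_eq_left hpos.le]

end TVFlow

theorem mainTheorem2 (u₀ : ℝ → ℝ) (u : ℝ → ℝ → ℝ)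
    (hint : Integrable u₀) (hnonneg : ∀ᵐ x, 0 ≤ u₀ x)
    (hsupp : ∃ K : Set ℝ, IsCompact K ∧ ∀ᵐ x, x ∉ K → u₀ x = 0)
    (hu : TVFlow.IsCauchySolution u₀ u) :
    ∃ T : ℝ, T = (1 / 2) * ∫ x, u₀ x ∧
      (∀ t, 0 ≤ t → t ≤ T →
        ∫ x, u t x = (∫ x, u₀ x) - 2 * t ∧ (∫ x, u₀ x) - 2 * t = 2 * (T - t)) ∧
      TVFlow.IsExtinctionTime u T := by
  have h := hu.isCalibratedFlow
  obtain ⟨K, hK, hKz⟩ := hsupp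
  obtain ⟨R, hR0, hR⟩ := hK.isBounded.exists_pos_norm_le
  have hout : ∀ᵐ x, R < |x| → u 0 x = 0 := by
    filter_upwards [hKz, hu.initial] with x h1 h2 hx
    rw [h2]
    exact h1 fun hxK => absurd (hR x hxK) (not_le.mpr hx)
  have hnn : ∀ t, 0 ≤ t → ∀ᵐ x, 0 ≤ u t x := by
    intro t ht
    have h0 : ∀ᵐ x, x ∈ (univ : Set ℝ) → 0 ≤ u 0 x := by
      filter_upwards [hnonneg, hu.initial] with x h1 h2 _
      rwa [h2]
    filter_upwards [h.ae_nonneg (Or.inl rfl) h0 ht] with x hx using hx (mem_univ x)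
  have hA : ∀ t, 0 ≤ t → ∀ᵐ x, x < -R → u t x = 0 := fun t ht =>
    h.ae_eq_zero (S := Iio (-R)) (Or.inr (Or.inr ⟨_, rfl⟩)) (by
      filter_upwards [hout] with x hx hxR
      exact hx (lt_abs.mpr (Or.inr (by linarith [mem_Iio.mp hxR])))) ht
  have hB : ∀ t, 0 ≤ t → ∀ᵐ x, R < x → u t x = 0 := fun t ht =>
    h.ae_eq_zero (S := Ioi R) (Or.inr (Or.inl ⟨_, rfl⟩)) (by
      filter_upwards [hout] with x hx hxR
      exact hx (lt_abs.mpr (Or.inl hxR))) ht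
  have hmass : ∀ t, 0 ≤ t → ∫ x, u t x = max ((∫ x, u₀ x) - 2 * t) 0 := by
    intro t ht
    rw [← integral_congr_ae hu.initial]
    exact h.mass_eq_max hnn (by linarith) hA hB ht
  have hm0 : 0 ≤ ∫ x, u₀ x := integral_nonneg_of_ae hnonneg
  refine ⟨(1 / 2) * ∫ x, u₀ x, rfl, fun t ht htT => ⟨?_, by ring⟩, ⟨by positivity, ?_⟩, ?_⟩
  · rw [hmass t ht, max_eq_left (by linarith)]
  · intro t ht
    have ht0 : 0 ≤ t := le_trans (by positivity) ht
    refine (integral_eq_zero_iff_of_nonneg_ae (hnn t ht0) (h.integrable t ht0)).mp ?_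
    rw [hmass t ht0, max_eq_right (by linarith)]
  · rintro s ⟨hs0, hs⟩
    have h1 := hmass s hs0
    rw [integral_eq_zero_of_ae (hs s le_rfl)] at h1
    linarith [le_max_left ((∫ x, u₀ x) - 2 * s) 0]
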